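/- Let $G$ be a metric graph with finitely many vertices and finitely many edges, where each edge $e$ is identified with an interval $[0,L_e]$, $0<L_e<\infty$ (loops and multiple edges are allowed). Let $U\in L^2(G,\mathbb{R})$. At each vertex $v$, with the adjacent edges enumerated $1,\dots,\alpha$ (a loop counted twice), put $\vec f_v=(f_1(v),\dots,f_\alpha(v))$ and $\vec f_v{}'=(f_1'(v),\dots,f_\alpha'(v))$, the derivatives being taken in the direction away from $v$, and let complex $\alpha\times\alpha$ matrices $A_v,B_v$ be given such that $A_vB_v^*$ is self-adjoint, $(A_v,B_v)$ has full rank $\alpha$, and the conditions are non-Robin, that is, $$\sigma^v=-(A_v+ikB_v)^{-1}(A_v-ikB_v)$$ is independent of $k\in\mathbb{R}\setminus\{0\}$. Let $\mathbb{K}$ be $\mathbb{R}$ or $\mathbb{C}$, and let $$Df=-(f''+Uf)$$ be the operator in $L^2(G,\mathbb{K})=\bigoplus_e L^2([0,L_e],\mathbb{K})$ whose domain consists of the functions $f$ that are $C^1$ on each closed edge with absolutely continuous derivative, with $Df\in L^2(G,\mathbb{K})$, and with $A_v\vec f_v+B_v\vec f_v{}'=0$ at every vertex $v$. (A function on $G$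 is a family of functions on the closed edges; it need not be continuous at the vertices.) Let $\{\lambda_j,\theta_j\}_j$ be a spectral resolution of $D$: the $\lambda_j$ are real, each $\theta_j$ is in the domain of $D$ and satisfies $D\theta_j=\lambda_j\theta_j$, and the $\theta_j$ form an orthonormal basis of $L^2(G,\mathbb{K})$. Then there is a constant $C$, independent of $j$ and of $x$, such that $$|\theta_j(x)|<C$$ for all $j$ and all $x\in G$ (including the boundary values at the ends of every edge). -/

import Mathlib

open MeasureTheory Set

noncomputable section

/-- A metric graph with vertices `V` and edges `E`. The edge `e` is a copy of the interval
`[0, length e]`, its endpoint `0` sits at the vertex `src e` and its endpoint `length e` at the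
vertex `tgt e`. Loops, multiple edges, isolated vertices and several connected components are
allowed. The orientation of an edge only serves to parametrize it. -/
structure MetricGraph (V E : Type*) where
  src : E → V
  tgt : E → V
  length : E → ℝ
  length_pos : ∀ e, 0 < length e

namespace MetricGraph

variable {V E : Type*} (Γ : MetricGraph V E)

/-- The vertex at one end of an edge: `(e, false)` is the initial end of `e`, the point `0`, and
`(e, true)` is the terminal end of `e`, the point `length e`. -/
def endVertex (d : E × Bool) : V := if d.2 then Γ.tgt d.1 else Γ.src d.1

/-- The edge ends at the vertex `v`, that is, the edges adjacent to `v`, with a loop at `v`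
counted twice. -/
abbrev EndsAt (v : V) : Type _ := {d : E × Bool // Γ.endVertex d = v}

/-- A function on the graph, given by its restrictions to the closed edges `[0, length e]`; the
values outside of these intervals are irrelevant. The restrictions need not agree at a common
vertex, since general vertex conditions do not make functions continuous there. -/
abbrev Fn (_Γ : MetricGraph V E) (𝕜 : Type*) : Type _ := E → ℝ → 𝕜

/-- Lebesgue measure on the edge `e`. -/
def edgeMeasure (e : E) : Measure ℝ := volume.restrict (Icc 0 (Γ.length e))

/-- The Hilbert space `L²(G, 𝕜)`, the orthogonal direct sum of the spaces
`L²([0, length e], 𝕜)` over the edges. -/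
abbrev L2 [Fintype E] (𝕜 : Type*) [RCLike 𝕜] : Type _ :=
  PiLp 2 (fun e : E => Lp 𝕜 2 (Γ.edgeMeasure e))

variable {𝕜 : Type*} [RCLike 𝕜]

/-- The first derivative of `f` on the edges (one-sided at the endpoints). -/
def edgeDeriv (f : Γ.Fn 𝕜) : Γ.Fn 𝕜 :=
  fun e x => derivWithin (f e) (Icc 0 (Γ.length e)) x

/-- The value of `f` at an end of an edge, as a complex number. -/
def endValue (f : Γ.Fn 𝕜) (d : E × Bool) : ℂ :=
  RCLike.map 𝕜 ℂ (if d.2 then f d.1 (Γ.length d.1) else f d.1 0)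

/-- The derivative of `f` at an end of an edge in the direction pointing away from the vertex, as
a complex number. -/
def endDeriv (f : Γ.Fn 𝕜) (d : E × Bool) : ℂ :=
  RCLike.map 𝕜 ℂ
    (if d.2 then -Γ.edgeDeriv f d.1 (Γ.length d.1) else Γ.edgeDeriv f d.1 0)

/-- Matrices `A_v`, `B_v` for the vertex conditions `A_v f_v + B_v f_v' = 0` at all vertices. -/
structure VertexMatrices where
  A : ∀ v, Matrix (Γ.EndsAt v) (Γ.EndsAt v) ℂ
  B : ∀ v, Matrix (Γ.EndsAt v) (Γ.EndsAt v) ℂ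

namespace VertexMatrices

variable {Γ} [Fintype E] [DecidableEq E] [DecidableEq V]

/-- The vertex scattering matrix `σ^v = -(A_v + i k B_v)⁻¹ (A_v - i k B_v)`. -/
def sigma (bc : Γ.VertexMatrices) (v : V) (k : ℝ) :
    Matrix (Γ.EndsAt v) (Γ.EndsAt v) ℂ :=
  -((bc.A v + (Complex.I * (k : ℂ)) • bc.B v)⁻¹ * (bc.A v - (Complex.I * (k : ℂ)) • bc.B v))

/-- The self-adjointness conditions: at each vertex `A_v B_v^*` is self-adjoint and the matrix
`(A_v, B_v)` has full rank. -/
def IsSelfAdjoint (bc : Γ.VertexMatrices) : Prop :=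
  ∀ v, (bc.A v * (bc.B v).conjTranspose).IsHermitian ∧
    (Matrix.fromCols (bc.A v) (bc.B v)).rank = Fintype.card (Γ.EndsAt v)

/-- The vertex conditions are of non-Robin type: `σ^v` does not depend on `k`. The value `k = 0`
is left out, because `A_v + i k B_v` need not be invertible there, whereas it is invertible for
all real `k ≠ 0` if the vertex conditions are self-adjoint. -/
def IsNonRobin (bc : Γ.VertexMatrices) : Prop :=
  ∀ v, ∀ k k' : ℝ, k ≠ 0 → k' ≠ 0 → bc.sigma v k = bc.sigma v k'

/-- `f` satisfies the vertex conditions `A_v f_v + B_v f_v' = 0` at all vertices `v`. -/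
def Satisfies (bc : Γ.VertexMatrices) (f : Γ.Fn 𝕜) : Prop :=
  ∀ v, (bc.A v).mulVec (fun d => Γ.endValue f d.1) +
    (bc.B v).mulVec (fun d => Γ.endDeriv f d.1) = 0

end VertexMatrices

/-- The differential expression `D f = -(f'' + U f)` on the edges. -/
def opD (U : Γ.Fn ℝ) (f : Γ.Fn 𝕜) : Γ.Fn 𝕜 :=
  fun e x => -(deriv (Γ.edgeDeriv f e) x + (U e x : 𝕜) * f e x)

variable [Fintype E] [DecidableEq E] [DecidableEq V]

/-- The domain of the operator `D`: on each closed edge `f` is `C¹` with an absolutely continuous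
derivative, `D f` is in `L²`, and `f` satisfies the vertex conditions. -/
structure InDomain (bc : Γ.VertexMatrices) (U : Γ.Fn ℝ) (f : Γ.Fn 𝕜) : Prop where
  contDiffOn : ∀ e, ContDiffOn ℝ 1 (f e) (Icc 0 (Γ.length e))
  absolutelyContinuous : ∀ e, AbsolutelyContinuousOnInterval (Γ.edgeDeriv f e) 0 (Γ.length e)
  memLp : ∀ e, MemLp (Γ.opD U f e) 2 (Γ.edgeMeasure e)
  vertex : bc.Satisfies f

/-- A spectral resolution `{lam j, θ j}` of `D`: the function `θ j` is in the domain of `D` and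
satisfies `D (θ j) = lam j • θ j`, and the `θ j` form an orthonormal basis of `L²(G, 𝕜)`. -/
structure IsSpectralResolution (bc : Γ.VertexMatrices) (U : Γ.Fn ℝ) {ι : Type*}
    (lam : ι → ℝ) (θ : ι → Γ.Fn 𝕜) : Prop where
  inDomain : ∀ j, Γ.InDomain bc U (θ j)
  eigen : ∀ j e, ∀ᵐ x ∂Γ.edgeMeasure e, Γ.opD U (θ j) e x = (lam j : 𝕜) * θ j e x
  basis : ∃ b : HilbertBasis ι 𝕜 (Γ.L2 𝕜), ∀ j e, b j e =ᵐ[Γ.edgeMeasure e] θ j e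

end MetricGraph

end

/-!
Why eigenfunctions of `D` are uniformly bounded: an eigenfunction `f` with eigenvalue `l` satisfies
`f'' = -(l + U) f` on each edge. The equation has real coefficients, so it suffices to bound real
solutions `u` (the real and the imaginary part of `f`) in terms of `∫ u ^ 2`. Two regimes are treated
separately, with a threshold for `l` that depends only on the graph and on the potential.

* High energy, `l = k ^ 2` with `k` large. On a single edge the quantity `u' ^ 2 + k ^ 2 u ^ 2` has
  derivative `-2 U u u'`, which is `O(|U| / k)` relative to it; so it is comparable to its maximum `M`
  along the whole edge. The energy identity shows that `k ^ 2 ∫ u ^ 2` takes about half of its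
  integral, so `k ^ 2 u ^ 2 ≤ M` is bounded by a multiple of `k ^ 2 ∫ u ^ 2`. Vertex conditions play no
  role (`IsSchrodingerSolution.sq_le_of_high_energy`).

* Energies bounded above (large negative ones included). The energy identity
  `∫ u' ^ 2 = [u u'] + l ∫ u ^ 2 + ∫ U u ^ 2` and the Sobolev inequality bound `∫ u' ^ 2` by the boundary
  terms and a multiple of `∫ u ^ 2` (`IsSchrodingerSolution.exists_low_energy_bound`). Summed over the
  edges, the boundary terms cancel, because non-Robin vertex conditions make the vector of values
  orthogonal to the vector of outward derivatives at every vertex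
  (`Matrix.star_dotProduct_eq_zero_of_nonRobin`, `MetricGraph.sum_boundary_eq_zero`). Hence the
  Dirichlet integral of a normalized eigenfunction is bounded, and by Sobolev so is its supremum.
-/

/-! ### Schrödinger equations on an interval -/

/-- The oscillation of an absolutely continuous function is bounded by the integral of any bound for
its derivative. -/
theorem AbsolutelyContinuousOnInterval.abs_sub_le_integral {f h : ℝ → ℝ} {a b : ℝ} (hab : a ≤ b)
    (hf : AbsolutelyContinuousOnInterval f a b) (hh : IntervalIntegrable h volume a b)
    (hfh : ∀ᵐ t, t ∈ Icc a b → |deriv f t| ≤ h t) {x y : ℝ} (hx : x ∈ Icc a b)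
    (hy : y ∈ Icc a b) : |f x - f y| ≤ ∫ t in a..b, h t := by
  wlog hyx : y ≤ x generalizing x y
  · rw [abs_sub_comm]
    exact this hy hx (le_of_not_ge hyx)
  have hsub : Icc y x ⊆ Icc a b := Icc_subset_Icc hy.1 hx.2
  have hsub' : uIcc y x ⊆ uIcc a b := by rwa [uIcc_of_le hyx, uIcc_of_le hab]
  rw [← (hf.mono hsub').integral_deriv_eq_sub]
  have h1 : |∫ t in y..x, deriv f t| ≤ ∫ t in y..x, h t := by
    rw [← Real.norm_eq_abs]
    refine intervalIntegral.norm_integral_le_of_norm_le hyx ?_ (hh.mono_set hsub')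
    filter_upwards [hfh] with t ht htx
    exact ht (hsub (Ioc_subset_Icc_self htx))
  refine h1.trans (intervalIntegral.integral_mono_interval hy.1 hyx hx.2 ?_ hh)
  rw [Filter.EventuallyLE, ae_restrict_iff' measurableSet_Ioc]
  filter_upwards [hfh] with t ht htx
  exact (abs_nonneg _).trans (ht (Ioc_subset_Icc_self htx))

theorem intervalIntegral.abs_integral_mul_sq_le {L M : ℝ} {q u : ℝ → ℝ} (hL : 0 ≤ L)
    (hq : IntervalIntegrable q volume 0 L) (hM : ∀ x ∈ Icc 0 L, u x ^ 2 ≤ M) :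
    |∫ t in 0..L, q t * u t ^ 2| ≤ (∫ t in 0..L, |q t|) * M := by
  rw [← intervalIntegral.integral_mul_const, ← Real.norm_eq_abs]
  refine intervalIntegral.norm_integral_le_of_norm_le hL (.of_forall fun t ht => ?_)
    (hq.abs.mul_const _)
  rw [Real.norm_eq_abs, abs_mul, abs_of_nonneg (sq_nonneg (u t))]
  exact mul_le_mul_of_nonneg_left (hM t (Ioc_subset_Icc_self ht)) (abs_nonneg _)

/-- A real solution `u` on `[0, L]` of the Schrödinger equation `u'' = -(μ + q) u` with energy `μ`
and potential `-q`, where `p` is the derivative of `u`. Both functions are absolutely continuous,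
and the equations hold almost everywhere. -/
structure IsSchrodingerSolution (L μ : ℝ) (q u p : ℝ → ℝ) : Prop where
  ac : AbsolutelyContinuousOnInterval u 0 L
  ac_deriv : AbsolutelyContinuousOnInterval p 0 L
  deriv_eq : ∀ᵐ x, x ∈ Icc 0 L → deriv u x = p x
  deriv_deriv_eq : ∀ᵐ x, x ∈ Icc 0 L → deriv p x = -(μ + q x) * u x

namespace IsSchrodingerSolution

variable {L μ : ℝ} {q u p : ℝ → ℝ}

theorem intervalIntegrable_sq (h : IsSchrodingerSolution L μ q u p) :
    IntervalIntegrable (fun x => u x ^ 2) volume 0 L :=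
  (h.ac.continuousOn.pow 2).intervalIntegrable

theorem intervalIntegrable_deriv_sq (h : IsSchrodingerSolution L μ q u p) :
    IntervalIntegrable (fun x => p x ^ 2) volume 0 L :=
  (h.ac_deriv.continuousOn.pow 2).intervalIntegrable

theorem intervalIntegrable_mul_sq (h : IsSchrodingerSolution L μ q u p)
    (hq : IntervalIntegrable q volume 0 L) :
    IntervalIntegrable (fun x => q x * u x ^ 2) volume 0 L :=
  hq.mul_continuousOn (h.ac.continuousOn.pow 2)

/-- The one-dimensional Sobolev inequality, with an arbitrarily small weight on the derivative. -/
theorem sq_le_integral (h : IsSchrodingerSolution L μ q u p) (hL : 0 < L) {ε : ℝ} (hε : 0 < ε)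
    {x : ℝ} (hx : x ∈ Icc 0 L) :
    u x ^ 2 ≤ (L⁻¹ + ε⁻¹) * (∫ t in 0..L, u t ^ 2) + ε * ∫ t in 0..L, p t ^ 2 := by
  have hcont : ContinuousOn u (Icc 0 L) := by
    simpa only [uIcc_of_le hL.le] using h.ac.continuousOn
  -- at a minimum `y` of `u ^ 2`, the value is at most the mean
  obtain ⟨y, hy, hmin⟩ := isCompact_Icc.exists_isMinOn (nonempty_Icc.2 hL.le) (hcont.pow 2)
  have hmean : u y ^ 2 ≤ L⁻¹ * ∫ t in 0..L, u t ^ 2 := by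
    have h1 : ∫ _ in 0..L, u y ^ 2 ≤ ∫ t in 0..L, u t ^ 2 :=
      intervalIntegral.integral_mono_on hL.le (by simp) h.intervalIntegrable_sq fun t ht => hmin ht
    rw [intervalIntegral.integral_const, smul_eq_mul, sub_zero] at h1
    rwa [le_inv_mul_iff₀ hL]
  have hosc : |(u * u) x - (u * u) y| ≤ ∫ t in 0..L, (ε⁻¹ * u t ^ 2 + ε * p t ^ 2) := by
    refine (h.ac.mul h.ac).abs_sub_le_integral hL.le
      ((h.intervalIntegrable_sq.const_mul _).add (h.intervalIntegrable_deriv_sq.const_mul _))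
      ?_ hx hy
    filter_upwards [h.ac.ae_differentiableAt, h.deriv_eq] with t ht1 ht2 ht
    rw [deriv_mul (ht1 (by rwa [uIcc_of_le hL.le])) (ht1 (by rwa [uIcc_of_le hL.le])), ht2 ht]
    have hs : √ε ^ 2 = ε := Real.sq_sqrt hε.le
    have hs0 : √ε ≠ 0 := (Real.sqrt_pos.2 hε).ne'
    have e1 : ε⁻¹ * u t ^ 2 = ((√ε)⁻¹ * u t) ^ 2 := by rw [mul_pow, inv_pow, hs]
    have e2 : ε * p t ^ 2 = (√ε * p t) ^ 2 := by rw [mul_pow, hs]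
    have e3 : u t * p t = ((√ε)⁻¹ * u t) * (√ε * p t) := by field_simp
    rw [mul_comm (p t), e1, e2, e3, abs_le]
    constructor <;> nlinarith [sq_nonneg ((√ε)⁻¹ * u t + √ε * p t),
      sq_nonneg ((√ε)⁻¹ * u t - √ε * p t)]
  rw [intervalIntegral.integral_add (h.intervalIntegrable_sq.const_mul _)
    (h.intervalIntegrable_deriv_sq.const_mul _), intervalIntegral.integral_const_mul,
    intervalIntegral.integral_const_mul] at hosc
  have := (abs_le.1 hosc).2
  simp only [Pi.mul_apply] at this
  linarith

/-- The energy identity, obtained by multiplying the equation by `u` and integrating by parts. -/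
theorem integral_deriv_sq (h : IsSchrodingerSolution L μ q u p) (hL : 0 ≤ L)
    (hq : IntervalIntegrable q volume 0 L) :
    ∫ t in 0..L, p t ^ 2 = u L * p L - u 0 * p 0 + μ * (∫ t in 0..L, u t ^ 2)
      + ∫ t in 0..L, q t * u t ^ 2 := by
  have hIoc : ∀ {t}, t ∈ uIoc 0 L → t ∈ Icc 0 L := fun ht => by
    rw [uIoc_of_le hL] at ht; exact Ioc_subset_Icc_self ht
  have h1 := h.ac.integral_deriv_mul_eq_sub h.ac_deriv
  have h2 : ∫ t in 0..L, deriv u t * p t + u t * deriv p t =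
      ∫ t in 0..L, (p t ^ 2 - (μ * u t ^ 2 + q t * u t ^ 2)) := by
    refine intervalIntegral.integral_congr_ae ?_
    filter_upwards [h.deriv_eq, h.deriv_deriv_eq] with t h3 h4 ht
    rw [h3 (hIoc ht), h4 (hIoc ht)]
    ring
  rw [h2, intervalIntegral.integral_sub h.intervalIntegrable_deriv_sq
    ((h.intervalIntegrable_sq.const_mul _).add (h.intervalIntegrable_mul_sq hq)),
    intervalIntegral.integral_add (h.intervalIntegrable_sq.const_mul _)
    (h.intervalIntegrable_mul_sq hq), intervalIntegral.integral_const_mul] at h1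
  linarith

/-- For a fixed potential, the energy identity and the Sobolev inequality give bounds with a constant
that does not depend on the energy `μ`. -/
theorem exists_low_energy_bound (hL : 0 < L) (hq : IntervalIntegrable q volume 0 L) :
    ∃ K : ℝ, 0 ≤ K ∧ ∀ (μ : ℝ) (u p : ℝ → ℝ), IsSchrodingerSolution L μ q u p →
      (∫ t in 0..L, p t ^ 2) ≤ 2 * (u L * p L - u 0 * p 0) + (2 * μ + K) * ∫ t in 0..L, u t ^ 2 ∧
      ∀ x ∈ Icc 0 L, u x ^ 2 ≤ K * ((∫ t in 0..L, u t ^ 2) + ∫ t in 0..L, p t ^ 2) := by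
  set Q : ℝ := ∫ t in 0..L, |q t|
  have hQ : 0 ≤ Q := intervalIntegral.integral_nonneg hL.le fun _ _ => abs_nonneg _
  -- the weight `ε` is chosen so that `Q * ε ≤ 1 / 2`: the potential term is absorbed by `∫ p ^ 2`
  set ε : ℝ := (2 * (Q + 1))⁻¹ with hε
  have hε0 : 0 < ε := by positivity
  have hQε : Q * ε ≤ 1 / 2 := by
    rw [hε, ← div_eq_mul_inv, div_le_iff₀ (by positivity)]; linarith
  set c : ℝ := L⁻¹ + ε⁻¹
  have hc : 0 < c := by positivity
  refine ⟨2 * Q * c + c + ε, by positivity, fun μ u p h => ?_⟩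
  have hu0 : 0 ≤ ∫ t in 0..L, u t ^ 2 :=
    intervalIntegral.integral_nonneg hL.le fun _ _ => sq_nonneg _
  have hp0 : 0 ≤ ∫ t in 0..L, p t ^ 2 :=
    intervalIntegral.integral_nonneg hL.le fun _ _ => sq_nonneg _
  have hsup := fun x (hx : x ∈ Icc 0 L) => h.sq_le_integral hL hε0 hx
  have h1 := h.integral_deriv_sq hL.le hq
  have h2 := (abs_le.1 (intervalIntegral.abs_integral_mul_sq_le hL.le hq hsup)).2
  generalize (∫ t in 0..L, u t ^ 2) = N at *
  generalize (∫ t in 0..L, p t ^ 2) = P at *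
  constructor
  · have h3 : Q * ε * P ≤ 1 / 2 * P := mul_le_mul_of_nonneg_right hQε hp0
    have h4 : 0 ≤ (c + ε) * N := by positivity
    change _ ≤ Q * (c * N + ε * P) at h2
    linarith
  · intro x hx
    have h5 : 0 ≤ (2 * Q * c + ε) * N := by positivity
    have h6 : 0 ≤ (2 * Q * c + c) * P := by positivity
    have h7 := hsup x hx
    change _ ≤ c * N + ε * P at h7
    linarith

/-- At high energy `k ^ 2`, the quantity `p ^ 2 + k ^ 2 * u ^ 2` is nearly constant along the edge and
`u` takes its share of it, whatever the boundary conditions are. -/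
theorem sq_le_of_high_energy {k : ℝ} (h : IsSchrodingerSolution L (k ^ 2) q u p) (hL : 0 < L)
    (hq : IntervalIntegrable q volume 0 L) (hk : 0 < k) (hkQ : 2 * (∫ t in 0..L, |q t|) ≤ k)
    (hkL : 8 ≤ k * L) {x : ℝ} (hx : x ∈ Icc 0 L) :
    u x ^ 2 ≤ 8 / L * ∫ t in 0..L, u t ^ 2 := by
  set Q : ℝ := ∫ t in 0..L, |q t|
  have hQ : 0 ≤ Q := intervalIntegral.integral_nonneg hL.le fun _ _ => abs_nonneg _
  set F : ℝ → ℝ := p * p + fun t => k ^ 2 * (u * u) t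
  have hF : ∀ t, F t = p t ^ 2 + k ^ 2 * u t ^ 2 := fun t => by
    simp only [F, Pi.add_apply, Pi.mul_apply]; ring
  have hFac : AbsolutelyContinuousOnInterval F 0 L :=
    (h.ac_deriv.mul h.ac_deriv).add ((h.ac.mul h.ac).const_mul _)
  have hFcont : ContinuousOn F (Icc 0 L) := by
    simpa only [uIcc_of_le hL.le] using hFac.continuousOn
  -- the maximum `M` of the energy density `F` controls all other quantities
  obtain ⟨z, hz, hmax⟩ := isCompact_Icc.exists_isMaxOn (nonempty_Icc.2 hL.le) hFcont
  set M := F z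
  have hM : ∀ t ∈ Icc 0 L, p t ^ 2 + k ^ 2 * u t ^ 2 ≤ M := fun t ht => hF t ▸ hmax ht
  have hM0 : 0 ≤ M := by rw [show M = F z from rfl, hF]; positivity
  have hup : ∀ t ∈ Icc 0 L, 2 * |u t * p t| ≤ M / k := fun t ht => by
    rw [le_div_iff₀ hk]
    refine le_trans ?_ (hM t ht)
    rcases abs_cases (u t * p t) with ⟨e, -⟩ | ⟨e, -⟩ <;> rw [e] <;>
      nlinarith [sq_nonneg (p t - k * u t), sq_nonneg (p t + k * u t)]
  -- `F` loses at most half of its maximum, since `|F'| ≤ |q| * M / k` and `Q ≤ k / 2`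
  have hosc : ∀ t ∈ Icc 0 L, M - F t ≤ M / 2 := fun t ht => by
    have h1 : |F z - F t| ≤ ∫ s in 0..L, |q s| * (M / k) := by
      refine hFac.abs_sub_le_integral hL.le (hq.abs.mul_const _) ?_ hz ht
      filter_upwards [h.ac.ae_differentiableAt, h.ac_deriv.ae_differentiableAt, h.deriv_eq,
        h.deriv_deriv_eq] with s h1 h2 h3 h4 hs
      have hs' : s ∈ uIcc 0 L := by rwa [uIcc_of_le hL.le]
      have hu := (h1 hs').hasDerivAt
      have hp := (h2 hs').hasDerivAt
      rw [h3 hs] at hu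
      rw [h4 hs] at hp
      have hd : deriv F s = -(2 * q s * (u s * p s)) := by
        rw [((hp.mul hp).add ((hu.mul hu).const_mul (k ^ 2))).deriv]
        ring
      rw [hd, abs_neg, mul_assoc, mul_left_comm, abs_mul, abs_mul, abs_two]
      exact mul_le_mul_of_nonneg_left (hup s hs) (abs_nonneg _)
    rw [intervalIntegral.integral_mul_const] at h1
    refine (le_abs_self _).trans (h1.trans ?_)
    change Q * (M / k) ≤ _
    rw [mul_div_assoc', div_le_div_iff₀ hk two_pos]
    nlinarith
  have hF' : L * (M / 2) ≤ (∫ t in 0..L, p t ^ 2) + k ^ 2 * ∫ t in 0..L, u t ^ 2 := by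
    rw [← intervalIntegral.integral_const_mul, ← intervalIntegral.integral_add
      h.intervalIntegrable_deriv_sq (h.intervalIntegrable_sq.const_mul _)]
    have h1 : ∫ _ in 0..L, M / 2 ≤ ∫ t in 0..L, (p t ^ 2 + k ^ 2 * u t ^ 2) := by
      refine intervalIntegral.integral_mono_on hL.le (by simp)
        (h.intervalIntegrable_deriv_sq.add (h.intervalIntegrable_sq.const_mul _)) fun t ht => ?_
      rw [← hF]
      linarith [hosc t ht]
    simpa only [intervalIntegral.integral_const, smul_eq_mul, sub_zero] using h1
  -- the energy identity exchanges `∫ p ^ 2` for `k ^ 2 * ∫ u ^ 2`, up to errors `O(M / k)`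
  have henergy := h.integral_deriv_sq hL.le hq
  have hu2 : ∀ t ∈ Icc 0 L, u t ^ 2 ≤ M / k ^ 2 := fun t ht => by
    rw [le_div_iff₀ (by positivity)]
    linarith [hM t ht, sq_nonneg (p t)]
  have hpot := (abs_le.1 (intervalIntegral.abs_integral_mul_sq_le hL.le hq hu2)).2
  have hpot' : Q * (M / k ^ 2) ≤ M / k / 2 := by
    rw [mul_div_assoc', div_div, div_le_div_iff₀ (by positivity) (by positivity)]
    have : 0 ≤ M * k * (k - 2 * Q) := mul_nonneg (by positivity) (by linarith)
    nlinarith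
  have hMk : M / k ≤ M * L / 8 := by
    rw [div_le_div_iff₀ hk (by norm_num)]
    nlinarith
  have hb0 := hup 0 ⟨le_rfl, hL.le⟩
  have hbL := hup L ⟨hL.le, le_rfl⟩
  have hb0' := neg_abs_le (u 0 * p 0)
  have hbL' := le_abs_self (u L * p L)
  change _ ≤ Q * (M / k ^ 2) at hpot
  have hML : 0 ≤ M * L := by positivity
  have hN : M * L / 8 ≤ k ^ 2 * ∫ t in 0..L, u t ^ 2 := by linarith
  have hux := hu2 x hx
  rw [le_div_iff₀ (by positivity)] at hux
  rw [div_mul_eq_mul_div, le_div_iff₀ hL]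
  have hk2 : 0 < k ^ 2 := by positivity
  refine le_of_mul_le_mul_left ?_ hk2
  nlinarith

end IsSchrodingerSolution

/-! ### Vertex conditions of non-Robin type -/

namespace Matrix

variable {n : Type*} [Fintype n] [DecidableEq n]

theorem isUnit_of_rank_eq_card {K : Type*} [Field K] {M : Matrix n n K}
    (h : M.rank = Fintype.card n) : IsUnit M := by
  rw [← mulVec_surjective_iff_isUnit]
  have h1 : LinearMap.range M.mulVecLin = ⊤ := by
    apply Submodule.eq_top_of_finrank_eq
    rw [Module.finrank_fintype_fun_eq_card]
    exact h
  exact LinearMap.range_eq_top.1 h1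

open scoped ComplexOrder in
/-- For non-Robin self-adjoint vertex conditions, the values and the derivatives of a function at the
vertex are orthogonal. Indeed `S = (A + iB)⁻¹ (A - iB)` is then a Hermitian involution, and the vertex
conditions say that the values lie in its `-1`-eigenspace and the derivatives in its
`1`-eigenspace. -/
theorem star_dotProduct_eq_zero_of_nonRobin {A B : Matrix n n ℂ}
    (hAB : (A * Bᴴ).IsHermitian) (hrank : (fromCols A B).rank = Fintype.card n)
    (hS : (A + Complex.I • B)⁻¹ * (A - Complex.I • B) =
      (A - Complex.I • B)⁻¹ * (A + Complex.I • B)) {f f' : n → ℂ}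
    (hf : A *ᵥ f + B *ᵥ f' = 0) : star f ⬝ᵥ f' = 0 := by
  have hBA : B * Aᴴ = A * Bᴴ := by
    simpa only [IsHermitian, conjTranspose_mul, conjTranspose_conjTranspose] using hAB
  have hfrom : fromCols A B * (fromCols A B)ᴴ = A * Aᴴ + B * Bᴴ := by
    rw [conjTranspose_fromCols_eq_fromRows_conjTranspose, fromCols_mul_fromRows]
  have hPP : (A + Complex.I • B) * (A + Complex.I • B)ᴴ = A * Aᴴ + B * Bᴴ := by
    simp only [conjTranspose_add, conjTranspose_smul, Matrix.add_mul, Matrix.mul_add,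
      Matrix.smul_mul, Matrix.mul_smul, Matrix.mul_neg, hBA, Complex.star_def, Complex.conj_I,
      neg_smul, smul_add, smul_smul, Complex.I_mul_I]
    module
  have hQQ : (A - Complex.I • B) * (A - Complex.I • B)ᴴ = A * Aᴴ + B * Bᴴ := by
    simp only [conjTranspose_sub, conjTranspose_smul, Matrix.sub_mul, Matrix.mul_sub,
      Matrix.smul_mul, Matrix.mul_smul, Matrix.mul_neg, hBA, Complex.star_def, Complex.conj_I,
      neg_smul, smul_sub, smul_smul, Complex.I_mul_I]
    module
  -- `(A ± iB) (A ± iB)ᴴ = (A, B) (A, B)ᴴ` has full rank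
  have hP : IsUnit (A + Complex.I • B).det := by
    rw [← isUnit_iff_isUnit_det]
    apply isUnit_of_rank_eq_card
    rw [← rank_self_mul_conjTranspose, hPP, ← hfrom, rank_self_mul_conjTranspose, hrank]
  have hQ : IsUnit (A - Complex.I • B).det := by
    rw [← isUnit_iff_isUnit_det]
    apply isUnit_of_rank_eq_card
    rw [← rank_self_mul_conjTranspose, hQQ, ← hfrom, rank_self_mul_conjTranspose, hrank]
  have hPQf : (A + Complex.I • B) *ᵥ (f - Complex.I • f') +
      (A - Complex.I • B) *ᵥ (f + Complex.I • f') = 0 := by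
    have : (A + Complex.I • B) *ᵥ (f - Complex.I • f') +
        (A - Complex.I • B) *ᵥ (f + Complex.I • f') = (2 : ℂ) • (A *ᵥ f + B *ᵥ f') := by
      simp only [add_mulVec, sub_mulVec, mulVec_add, mulVec_sub, smul_mulVec, mulVec_smul,
        smul_sub, smul_add, smul_smul, Complex.I_mul_I]
      module
    rw [this, hf, smul_zero]
  generalize hPdef : A + Complex.I • B = P at *
  generalize hQdef : A - Complex.I • B = Q at *
  generalize hSdef : P⁻¹ * Q = S at *
  have hSS : S * S = 1 := by
    nth_rewrite 1 [← hSdef]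
    rw [hS, Matrix.mul_assoc, ← Matrix.mul_assoc Q, mul_nonsing_inv _ hQ, Matrix.one_mul,
      nonsing_inv_mul _ hP]
  have hSH : Sᴴ = S := by
    have h1 : P * Sᴴᴴ * Qᴴ = P * Pᴴ := by
      rw [conjTranspose_conjTranspose, ← hSdef, ← Matrix.mul_assoc P, mul_nonsing_inv _ hP,
        Matrix.one_mul, hQQ, hPP]
    have h2 : Q * Sᴴ * Pᴴ = P * Pᴴ := by
      have := congrArg conjTranspose h1
      simpa only [conjTranspose_mul, conjTranspose_conjTranspose, ← Matrix.mul_assoc] using this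
    have hPH : IsUnit Pᴴ.det := by rw [det_conjTranspose]; exact hP.star
    have h3 : Q * Sᴴ = P := by
      have := congrArg (· * Pᴴ⁻¹) h2
      simpa only [Matrix.mul_assoc, mul_nonsing_inv _ hPH, Matrix.mul_one] using this
    rw [← Matrix.one_mul Sᴴ, ← nonsing_inv_mul _ hQ, Matrix.mul_assoc, h3, hS]
  have h1 : f - Complex.I • f' = -(S *ᵥ (f + Complex.I • f')) := by
    have := congrArg (P⁻¹ *ᵥ ·) hPQf
    simp only [mulVec_add, mulVec_mulVec, nonsing_inv_mul _ hP, hSdef, one_mulVec, mulVec_zero]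
      at this
    rw [mulVec_add]
    exact eq_neg_of_add_eq_zero_left this
  have h2 : f + Complex.I • f' = -(S *ᵥ (f - Complex.I • f')) := by
    rw [h1, mulVec_neg, mulVec_mulVec, hSS, one_mulVec, neg_neg]
  have hSf : S *ᵥ f = -f := by
    have h3 : (2 : ℂ) • (S *ᵥ f) = (2 : ℂ) • -f := by
      rw [mulVec_add] at h1
      rw [mulVec_sub] at h2
      linear_combination (norm := module) h1 + h2
    exact smul_right_injective _ two_ne_zero h3
  have hSf' : S *ᵥ f' = f' := by
    have h3 : (2 * Complex.I) • (S *ᵥ f') = (2 * Complex.I) • f' := by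
      rw [mulVec_add] at h1
      rw [mulVec_sub] at h2
      simp only [mulVec_smul] at h1 h2
      linear_combination (norm := module) h1 - h2
    exact smul_right_injective _ (mul_ne_zero two_ne_zero Complex.I_ne_zero) h3
  have h4 : star f ⬝ᵥ f' = -(star f ⬝ᵥ f') := by
    calc star f ⬝ᵥ f' = star f ⬝ᵥ (S *ᵥ f') := by rw [hSf']
      _ = star (S *ᵥ f) ⬝ᵥ f' := by rw [star_mulVec, hSH, dotProduct_mulVec]
      _ = -(star f ⬝ᵥ f') := by rw [hSf, star_neg, neg_dotProduct]
  exact self_eq_neg.1 h4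

end Matrix

/-! ### Functions on a metric graph -/

theorem LipschitzWith.comp_absolutelyContinuousOnInterval {X Y : Type*} [PseudoMetricSpace X]
    [PseudoMetricSpace Y] {K : NNReal} {φ : X → Y} (hφ : LipschitzWith K φ) {f : ℝ → X} {a b : ℝ}
    (hf : AbsolutelyContinuousOnInterval f a b) :
    AbsolutelyContinuousOnInterval (φ ∘ f) a b := by
  refine squeeze_zero (fun t => Finset.sum_nonneg fun i _ => dist_nonneg) (fun t => ?_)
    (by simpa using Filter.Tendsto.const_mul (K : ℝ) hf)
  rw [Finset.mul_sum]
  exact Finset.sum_le_sum fun i _ => hφ.dist_le_mul _ _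

namespace MetricGraph

variable {V E : Type*} {Γ : MetricGraph V E} {𝕜 : Type*} [RCLike 𝕜]

theorem ae_edgeMeasure_iff {e : E} {P : ℝ → Prop} :
    (∀ᵐ x ∂Γ.edgeMeasure e, P x) ↔ ∀ᵐ x, x ∈ Icc 0 (Γ.length e) → P x :=
  ae_restrict_iff' measurableSet_Icc

theorem integral_edgeMeasure (e : E) (f : ℝ → ℝ) :
    ∫ x, f x ∂Γ.edgeMeasure e = ∫ x in 0..Γ.length e, f x := by
  rw [edgeMeasure, integral_Icc_eq_integral_Ioc,
    intervalIntegral.integral_of_le (Γ.length_pos e).le]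

theorem intervalIntegrable_of_memLp {q : ℝ → ℝ} {e : E} (hq : MemLp q 2 (Γ.edgeMeasure e)) :
    IntervalIntegrable q volume 0 (Γ.length e) := by
  have : IsFiniteMeasure (Γ.edgeMeasure e) := by unfold edgeMeasure; infer_instance
  rw [intervalIntegrable_iff_integrableOn_Icc_of_le (Γ.length_pos e).le]
  exact hq.integrable one_le_two

/-- The norm of `L²(G, 𝕜)` computed on a representative. -/
theorem sum_integral_norm_sq_eq_norm_sq [Fintype E] {f : Γ.Fn 𝕜} {g : Γ.L2 𝕜}
    (hfg : ∀ e, g e =ᵐ[Γ.edgeMeasure e] f e) :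
    ∑ e, ∫ x in 0..Γ.length e, ‖f e x‖ ^ 2 = ‖g‖ ^ 2 := by
  rw [PiLp.norm_sq_eq_of_L2]
  refine Finset.sum_congr rfl fun e _ => ?_
  rw [← integral_edgeMeasure, ← @inner_self_eq_norm_sq 𝕜, L2.inner_def]
  simp_rw [inner_self_eq_norm_sq_to_K, ← RCLike.ofReal_pow]
  rw [integral_ofReal, RCLike.ofReal_re]
  refine integral_congr_ae ?_
  filter_upwards [hfg e] with x hx
  rw [hx]

variable [Fintype E] [DecidableEq V]

/-- The equation `D f = l f` has real coefficients, so that real and imaginary parts of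
eigenfunctions are solutions. -/
theorem InDomain.isSchrodingerSolution {bc : Γ.VertexMatrices} {U : Γ.Fn ℝ} {f : Γ.Fn 𝕜}
    (hf : Γ.InDomain bc U f) {e : E} {l : ℝ}
    (heig : ∀ᵐ x ∂Γ.edgeMeasure e, Γ.opD U f e x = (l : 𝕜) * f e x) (φ : 𝕜 →L[ℝ] ℝ) :
    IsSchrodingerSolution (Γ.length e) l (U e) (fun x => φ (f e x))
      (fun x => φ (Γ.edgeDeriv f e x)) := by
  have hL := Γ.length_pos e
  have hc := hf.contDiffOn e
  refine ⟨?_, φ.lipschitz.comp_absolutelyContinuousOnInterval (hf.absolutelyContinuous e), ?_, ?_⟩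
  · refine φ.lipschitz.comp_absolutelyContinuousOnInterval
      (ContDiffOn.absolutelyContinuousOnInterval ?_)
    rwa [uIcc_of_le hL.le]
  · -- at interior points the one-sided derivative is the derivative
    filter_upwards [compl_mem_ae_iff.2 (measure_singleton (μ := volume) (0 : ℝ)),
      compl_mem_ae_iff.2 (measure_singleton (μ := volume) (Γ.length e))] with x h0 h1 hx
    have hnhds : Icc 0 (Γ.length e) ∈ nhds x :=
      Icc_mem_nhds (lt_of_le_of_ne hx.1 (Ne.symm h0)) (lt_of_le_of_ne hx.2 h1)
    have hd := ((hc.differentiableOn one_ne_zero) x hx).hasDerivWithinAt.hasDerivAt hnhds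
    exact (φ.hasFDerivAt.comp_hasDerivAt x hd).deriv
  · have hbv := (hf.absolutelyContinuous e).boundedVariationOn.ae_differentiableAt_of_mem_uIcc
    filter_upwards [hbv, ae_edgeMeasure_iff.1 heig] with x h1 h2 hx
    have hd := (h1 (by rwa [uIcc_of_le hL.le])).hasDerivAt
    have h3 : deriv (Γ.edgeDeriv f e) x = (-(l + U e x)) • f e x := by
      have h4 := h2 hx
      rw [opD] at h4
      rw [RCLike.real_smul_eq_coe_mul]
      push_cast
      linear_combination -h4
    exact (φ.hasFDerivAt.comp_hasDerivAt x hd).deriv.trans (by rw [h3, map_smul, smul_eq_mul])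

/-- The boundary form of a function that satisfies non-Robin vertex conditions vanishes: the boundary
terms of an integration by parts over the whole graph cancel. -/
theorem sum_boundary_eq_zero [Finite V] [DecidableEq E] {bc : Γ.VertexMatrices}
    (hbc : bc.IsSelfAdjoint) (hnr : bc.IsNonRobin) {f : Γ.Fn 𝕜} (hf : bc.Satisfies f) :
    ∑ e, ((RCLike.re (f e (Γ.length e)) * RCLike.re (Γ.edgeDeriv f e (Γ.length e)) -
        RCLike.re (f e 0) * RCLike.re (Γ.edgeDeriv f e 0)) +
      (RCLike.im (f e (Γ.length e)) * RCLike.im (Γ.edgeDeriv f e (Γ.length e)) -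
        RCLike.im (f e 0) * RCLike.im (Γ.edgeDeriv f e 0))) = 0 := by
  have := Fintype.ofFinite V
  have hv : ∀ v, ∑ d : Γ.EndsAt v,
      (star (Γ.endValue f d.1) * Γ.endDeriv f d.1).re = 0 := by
    intro v
    -- equality of the scattering matrices at `k = 1` and `k = -1` says that `S = S⁻¹`
    have hS := hnr v 1 (-1) one_ne_zero (neg_ne_zero.2 one_ne_zero)
    simp only [VertexMatrices.sigma, Complex.ofReal_one, Complex.ofReal_neg, mul_one, mul_neg,
      neg_smul, sub_neg_eq_add, ← sub_eq_add_neg, neg_inj] at hS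
    have h := Matrix.star_dotProduct_eq_zero_of_nonRobin (hbc v).1 (hbc v).2 hS (hf v)
    rw [← Complex.re_sum]
    exact congrArg Complex.re h
  have hsum : ∑ d : E × Bool, (star (Γ.endValue f d) * Γ.endDeriv f d).re = 0 := by
    rw [← Fintype.sum_fiberwise Γ.endVertex]
    exact Finset.sum_eq_zero fun v _ => hv v
  rw [Fintype.sum_prod_type, ← neg_eq_zero, ← Finset.sum_neg_distrib] at hsum
  refine (Finset.sum_congr rfl fun e _ => ?_).trans hsum
  simp [endValue, endDeriv]
  ring

end MetricGraph

/-! ### The uniform bound -/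

theorem theorem3p2 {V E : Type*} [Finite V] [Fintype E] [DecidableEq V] [DecidableEq E]
    (Γ : MetricGraph V E) {𝕜 : Type*} [RCLike 𝕜]
    (U : Γ.Fn ℝ) (hU : ∀ e, MemLp (U e) 2 (Γ.edgeMeasure e))
    (bc : Γ.VertexMatrices) (hbc : bc.IsSelfAdjoint) (hnr : bc.IsNonRobin)
    {ι : Type*} (lam : ι → ℝ) (θ : ι → Γ.Fn 𝕜)
    (hθ : Γ.IsSpectralResolution bc U lam θ) :
    ∃ C : ℝ, ∀ (j : ι) (e : E), ∀ x ∈ Icc (0 : ℝ) (Γ.length e), ‖θ j e x‖ < C := by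
  have hq := fun e => MetricGraph.intervalIntegrable_of_memLp (hU e)
  obtain ⟨b, hb⟩ := hθ.basis
  choose K hK0 hK using fun e =>
    IsSchrodingerSolution.exists_low_energy_bound (Γ.length_pos e) (hq e)
  set Q : E → ℝ := fun e => ∫ t in 0..Γ.length e, |U e t|
  have hQ : ∀ e, 0 ≤ Q e := fun e =>
    intervalIntegral.integral_nonneg (Γ.length_pos e).le fun _ _ => abs_nonneg _
  have hLinv : ∀ e, 0 ≤ 8 / Γ.length e := fun e => by have := Γ.length_pos e; positivity
  -- `κ` separates low and high energies: above `κ ^ 2` the high energy bound holds on each edge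
  set κ : ℝ := ∑ e, (2 * Q e + 8 / Γ.length e) + 1
  have hκ : 0 < κ :=
    add_pos_of_nonneg_of_pos
      (Finset.sum_nonneg fun e _ => add_nonneg (mul_nonneg two_pos.le (hQ e)) (hLinv e)) one_pos
  have hκe : ∀ e, 2 * Q e + 8 / Γ.length e ≤ κ := fun e => by
    have := Finset.single_le_sum (f := fun e => 2 * Q e + 8 / Γ.length e)
      (fun e _ => add_nonneg (mul_nonneg two_pos.le (hQ e)) (hLinv e)) (Finset.mem_univ e)
    exact this.trans (by simp [κ])
  set T : ℝ := ∑ e, K e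
  have hT : ∀ e, K e ≤ T := fun e =>
    Finset.single_le_sum (fun e _ => hK0 e) (Finset.mem_univ e)
  have hT0 : 0 ≤ T := Finset.sum_nonneg fun e _ => hK0 e
  set B : ℝ := T * (1 + (2 * κ ^ 2 + T)) + κ
  have hB : 0 < B := by positivity
  suffices h : ∀ j e, ∀ x ∈ Icc 0 (Γ.length e), ‖θ j e x‖ ^ 2 ≤ B from
    ⟨√B + 1, fun j e x hx => (Real.le_sqrt (norm_nonneg _) hB.le).2 (h j e x hx) |>.trans_lt
      (lt_add_one _)⟩
  intro j
  have hre := fun e => (hθ.inDomain j).isSchrodingerSolution (hθ.eigen j e) RCLike.reCLM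
  have him := fun e => (hθ.inDomain j).isSchrodingerSolution (hθ.eigen j e) RCLike.imCLM
  simp only [RCLike.reCLM_apply, RCLike.imCLM_apply] at hre him
  have hnorm : ∀ e x, ‖θ j e x‖ ^ 2 = RCLike.re (θ j e x) ^ 2 + RCLike.im (θ j e x) ^ 2 :=
    fun e x => by rw [RCLike.norm_sq_eq_def, sq, sq]
  have hN : ∑ e, ((∫ t in 0..Γ.length e, RCLike.re (θ j e t) ^ 2) +
      ∫ t in 0..Γ.length e, RCLike.im (θ j e t) ^ 2) = 1 := by
    have h1 := MetricGraph.sum_integral_norm_sq_eq_norm_sq (hb j)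
    rw [b.orthonormal.1 j, one_pow] at h1
    rw [← h1]
    refine Finset.sum_congr rfl fun e _ => ?_
    rw [← intervalIntegral.integral_add (hre e).intervalIntegrable_sq (him e).intervalIntegrable_sq]
    simp only [hnorm]
  have hnonneg : ∀ (e : E) (f : ℝ → ℝ), 0 ≤ ∫ t in 0..Γ.length e, f t ^ 2 := fun e f =>
    intervalIntegral.integral_nonneg (Γ.length_pos e).le fun _ _ => sq_nonneg _
  have hNe : ∀ e, (∫ t in 0..Γ.length e, RCLike.re (θ j e t) ^ 2) +
      ∫ t in 0..Γ.length e, RCLike.im (θ j e t) ^ 2 ≤ 1 := fun e => by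
    rw [← hN]
    exact Finset.single_le_sum (f := fun e => (∫ t in 0..Γ.length e, RCLike.re (θ j e t) ^ 2) +
      ∫ t in 0..Γ.length e, RCLike.im (θ j e t) ^ 2)
      (fun e _ => add_nonneg (hnonneg e _) (hnonneg e _)) (Finset.mem_univ e)
  rcases le_total (κ ^ 2) (lam j) with hlam | hlam
  · -- high energy: each edge can be treated on its own
    intro e x hx
    have hL := Γ.length_pos e
    have hk : κ ≤ √(lam j) := Real.le_sqrt_of_sq_le hlam
    have hk2 : √(lam j) ^ 2 = lam j := Real.sq_sqrt ((sq_nonneg κ).trans hlam)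
    have h1 : 2 * Q e ≤ √(lam j) := by linarith [hκe e, hLinv e]
    have h2 : 8 ≤ √(lam j) * Γ.length e := by
      rw [← div_le_iff₀ hL]
      linarith [hκe e, hQ e]
    have hre' := hre e
    have him' := him e
    rw [← hk2] at hre' him'
    have h3 := hre'.sq_le_of_high_energy hL (hq e) (hκ.trans_le hk) h1 h2 hx
    have h4 := him'.sq_le_of_high_energy hL (hq e) (hκ.trans_le hk) h1 h2 hx
    have h5 := mul_le_mul_of_nonneg_left (hNe e) (hLinv e)
    have h6 : 8 / Γ.length e ≤ B := by
      have : 0 ≤ T * (1 + (2 * κ ^ 2 + T)) := by positivity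
      linarith [hκe e, hQ e]
    rw [hnorm]
    linarith
  · -- low energy: the sum over all edges bounds the Dirichlet integral
    have hP : ∑ e, ((∫ t in 0..Γ.length e, RCLike.re (Γ.edgeDeriv (θ j) e t) ^ 2) +
        ∫ t in 0..Γ.length e, RCLike.im (Γ.edgeDeriv (θ j) e t) ^ 2) ≤ 2 * κ ^ 2 + T := by
      have hbd := MetricGraph.sum_boundary_eq_zero hbc hnr (hθ.inDomain j).vertex
      calc _ ≤ ∑ e, (2 * ((RCLike.re (θ j e (Γ.length e)) *
                RCLike.re (Γ.edgeDeriv (θ j) e (Γ.length e)) -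
              RCLike.re (θ j e 0) * RCLike.re (Γ.edgeDeriv (θ j) e 0)) +
            (RCLike.im (θ j e (Γ.length e)) * RCLike.im (Γ.edgeDeriv (θ j) e (Γ.length e)) -
              RCLike.im (θ j e 0) * RCLike.im (Γ.edgeDeriv (θ j) e 0))) +
            (2 * κ ^ 2 + T) * ((∫ t in 0..Γ.length e, RCLike.re (θ j e t) ^ 2) +
              ∫ t in 0..Γ.length e, RCLike.im (θ j e t) ^ 2)) := by
            refine Finset.sum_le_sum fun e _ => ?_
            have h1 := (hK e _ _ _ (hre e)).1
            have h2 := (hK e _ _ _ (him e)).1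
            have h3 : (2 * lam j + K e) * ((∫ t in 0..Γ.length e, RCLike.re (θ j e t) ^ 2) +
                ∫ t in 0..Γ.length e, RCLike.im (θ j e t) ^ 2) ≤
                (2 * κ ^ 2 + T) * ((∫ t in 0..Γ.length e, RCLike.re (θ j e t) ^ 2) +
                ∫ t in 0..Γ.length e, RCLike.im (θ j e t) ^ 2) :=
              mul_le_mul_of_nonneg_right (by linarith [hT e])
                (add_nonneg (hnonneg e _) (hnonneg e _))
            linarith
        _ = 2 * κ ^ 2 + T := by
            rw [Finset.sum_add_distrib, ← Finset.mul_sum, ← Finset.mul_sum, hbd, hN]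
            ring
    intro e x hx
    have h1 := (hK e _ _ _ (hre e)).2 x hx
    have h2 := (hK e _ _ _ (him e)).2 x hx
    have h3 := (Finset.single_le_sum
      (f := fun e => (∫ t in 0..Γ.length e, RCLike.re (Γ.edgeDeriv (θ j) e t) ^ 2) +
        ∫ t in 0..Γ.length e, RCLike.im (Γ.edgeDeriv (θ j) e t) ^ 2)
      (fun e _ => add_nonneg (hnonneg e _) (hnonneg e _)) (Finset.mem_univ e)).trans hP
    have h4 : K e * (((∫ t in 0..Γ.length e, RCLike.re (θ j e t) ^ 2) +
        ∫ t in 0..Γ.length e, RCLike.im (θ j e t) ^ 2) +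
        ((∫ t in 0..Γ.length e, RCLike.re (Γ.edgeDeriv (θ j) e t) ^ 2) +
        ∫ t in 0..Γ.length e, RCLike.im (Γ.edgeDeriv (θ j) e t) ^ 2)) ≤
        T * (1 + (2 * κ ^ 2 + T)) :=
      mul_le_mul (hT e) (add_le_add (hNe e) h3)
        (add_nonneg (add_nonneg (hnonneg e _) (hnonneg e _))
          (add_nonneg (hnonneg e _) (hnonneg e _))) hT0
    rw [hnorm]
    linarith
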